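/- Let $k\ge 2$ be an integer and let $q,z\in\mathbb{C}$ with $|q|<1$, $z\neq 0$, and $zq^{2j}\neq 1$, $z^{-1}q^{2j}\neq 1$ for all integers $j\ge 1$. Write $(a;q)_n=\prod_{i=0}^{n-1}(1-aq^i)$ for $n \ge 0$, $(a;q)_\infty=\prod_{i\ge 0}(1-aq^i)$ and $(a_1,\dots,a_r;q)_\infty=(a_1;q)_\infty\cdots(a_r;q)_\infty$, with the convention $1/(q^2;q^2)_{r}=0$ for integers $r<0$. For nonnegative integers $n_1,\dots,n_{k-1}$ put $N_j=n_j+n_{j+1}+\cdots+n_{k-1}$. Then $$ \begin{aligned} &(zq^2,z^{-1}q^2,q^2;q^2)_\infty\sum_{n=0}^{\infty}\frac{(q^2;q^2)_{2n}\,q^{2n}}{(zq^2;q^2)_n(z^{-1}q^2;q^2)_n}\\ &\qquad\times\sum_{n_1,\dots,n_{k-1}=0}^{\infty}\frac{(-1)^{n_{k-1}}q^{2N_1^2+\cdots+2N_{k-2}^2+3N_{k-1}^2+2N_1+\cdots+2N_{k-2}}\,(q;q^2)_{n_{k-1}}}{(q^2;q^2)_{n-N_1}(q^2;q^2)_{n_1}\cdots(q^2;q^2)_{n_{k-2}}(q^2;q^2)_{2n_{k-1}}}\\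 &=\sum_{n=0}^{\infty}\Bigl(\sum_{m=0}^{n}(-1)^n z^{m-n}q^{\frac12(2n^2-m^2)+\frac12(2n-m)+2(k-1)(m^2+m)}\\ &\qquad\qquad+\sum_{m=1}^{n}(-1)^n z^{n-m+1}q^{\frac12(2n^2-m^2)+\frac12(2n+m)+2(k-1)(m^2-m)}\Bigr), \end{aligned} $$ where the sum over $(n_1,\dots,n_{k-1})$ and the sums over $n$ on both sides converge absolutely. -/

import Mathlib

noncomputable section

namespace HeckeRogers

/-- The finite `q`-shifted factorial `(a;q)_n = ∏_{i<n} (1 - a q^i)`. -/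
def qPoch (a q : ℂ) (n : ℕ) : ℂ := ∏ i ∈ Finset.range n, (1 - a * q ^ i)

/-- The infinite `q`-shifted factorial `(a;q)_∞ = ∏_{i≥0} (1 - a q^i)`
(an absolutely convergent product for `‖q‖ < 1`). -/
def qPochInf (a q : ℂ) : ℂ := ∏' i : ℕ, (1 - a * q ^ i)

/-- `1 / (q;q)_{n-N}`, with the standard convention `1 / (q;q)_r = 0` for negative integers `r`. -/
def recipQPochSub (q : ℂ) (n N : ℕ) : ℂ := if N ≤ n then 1 / qPoch q q (n - N) else 0

/-- The entry `n_j`, `1 ≤ j ≤ k-1`, of a tuple `(n_1, …, n_{k-1})` of natural numbers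
(and `0` for other `j`). -/
def entry {k : ℕ} (ν : Fin (k - 1) → ℕ) (j : ℕ) : ℕ :=
  if h : 1 ≤ j ∧ j ≤ k - 1 then ν ⟨j - 1, by omega⟩ else 0

/-- `N_j = n_j + n_{j+1} + ⋯ + n_{k-1}`. -/
def tailSum {k : ℕ} (ν : Fin (k - 1) → ℕ) (j : ℕ) : ℕ :=
  ∑ i ∈ Finset.Icc j (k - 1), entry ν i

/-- The summand, for the tuple `(n_1, …, n_{k-1})`, of the inner `(k-1)`-fold sum:
`(-1)^{n_{k-1}} q^{2N_1²+⋯+2N_{k-2}²+3N_{k-1}²+2N_1+⋯+2N_{k-2}} (q;q²)_{n_{k-1}}` divided by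
`(q²;q²)_{n-N_1} (q²;q²)_{n_1} ⋯ (q²;q²)_{n_{k-2}} (q²;q²)_{2n_{k-1}}`. -/
def innerTerm (k : ℕ) (q : ℂ) (n : ℕ) (ν : Fin (k - 1) → ℕ) : ℂ :=
  (-1) ^ entry ν (k - 1)
    * q ^ ((∑ j ∈ Finset.Icc 1 (k - 2), 2 * tailSum ν j ^ 2) + 3 * tailSum ν (k - 1) ^ 2
        + ∑ j ∈ Finset.Icc 1 (k - 2), 2 * tailSum ν j)
    * qPoch q (q ^ 2) (entry ν (k - 1))
    * recipQPochSub (q ^ 2) n (tailSum ν 1)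
    / ((∏ j ∈ Finset.Icc 1 (k - 2), qPoch (q ^ 2) (q ^ 2) (entry ν j))
        * qPoch (q ^ 2) (q ^ 2) (2 * entry ν (k - 1)))

/-- The `n`-th term of the outer sum on the left-hand side. -/
def leftTerm (k : ℕ) (z q : ℂ) (n : ℕ) : ℂ :=
  qPoch (q ^ 2) (q ^ 2) (2 * n) * q ^ (2 * n)
    / (qPoch (z * q ^ 2) (q ^ 2) n * qPoch (z⁻¹ * q ^ 2) (q ^ 2) n)
    * ∑' ν : Fin (k - 1) → ℕ, innerTerm k q n ν

/-- The `n`-th term of the outer sum on the right-hand side. The exponents are integers, and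
the divisions by `2` in them are exact: `2n²-m²+2n∓m` is even. -/
def rightTerm (k : ℕ) (z q : ℂ) (n : ℕ) : ℂ :=
  (∑ m ∈ Finset.Icc 0 n, (-1) ^ n * z ^ ((m : ℤ) - n)
      * q ^ (((2 * (n : ℤ) ^ 2 - (m : ℤ) ^ 2) + (2 * (n : ℤ) - m)) / 2
          + 2 * ((k : ℤ) - 1) * ((m : ℤ) ^ 2 + m)))
  + ∑ m ∈ Finset.Icc 1 n, (-1) ^ n * z ^ ((n : ℤ) - m + 1)
      * q ^ (((2 * (n : ℤ) ^ 2 - (m : ℤ) ^ 2) + (2 * (n : ℤ) + m)) / 2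
          + 2 * ((k : ℤ) - 1) * ((m : ℤ) ^ 2 - m))

end HeckeRogers

end

namespace HeckeRogers

open Filter Topology Finset

/-! ### Finite and infinite `q`-shifted factorials -/

theorem choose_two_succ (n : ℕ) : (n + 1).choose 2 = n + n.choose 2 := by
  rw [Nat.choose_succ_succ' n 1, Nat.choose_one_right]

theorem choose_two_add (a b : ℕ) :
    (a + b).choose 2 = a.choose 2 + b.choose 2 + a * b := by
  induction b with
  | zero => simp
  | succ b ih => rw [← add_assoc, choose_two_succ, choose_two_succ, ih]; ring

theorem choose_two_add_choose_two_succ (b : ℕ) : b.choose 2 + (b + 1).choose 2 = b ^ 2 := by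
  induction b with
  | zero => simp
  | succ b ih => rw [choose_two_succ (b + 1), choose_two_succ b] at *; nlinarith

theorem qPoch_zero (a q : ℂ) : qPoch a q 0 = 1 := by simp [qPoch]

theorem qPoch_succ (a q : ℂ) (n : ℕ) : qPoch a q (n + 1) = qPoch a q n * (1 - a * q ^ n) := by
  simp [qPoch, prod_range_succ]

theorem qPoch_add (a q : ℂ) (m n : ℕ) :
    qPoch a q (m + n) = qPoch a q m * qPoch (a * q ^ m) q n := by
  simp [qPoch, prod_range_add, pow_add, mul_assoc]

theorem qPoch_ne_zero {a q : ℂ} (h : ∀ i : ℕ, a * q ^ i ≠ 1) (n : ℕ) : qPoch a q n ≠ 0 :=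
  prod_ne_zero_iff.2 fun i _ => sub_ne_zero.2 (h i).symm

theorem pow_succ_ne_one {q : ℂ} (hq : ‖q‖ < 1) (i : ℕ) : q ^ (i + 1) ≠ 1 := by
  intro h
  have h1 : ‖q‖ ^ (i + 1) = 1 := by rw [← norm_pow, h, norm_one]
  exact (pow_lt_one₀ (norm_nonneg q) hq i.succ_ne_zero).ne h1

theorem self_mul_pow_ne_one {q : ℂ} (hq : ‖q‖ < 1) (i : ℕ) : q * q ^ i ≠ 1 := by
  rw [← pow_succ']; exact pow_succ_ne_one hq i

theorem qPoch_self_ne_zero {q : ℂ} (hq : ‖q‖ < 1) (n : ℕ) : qPoch q q n ≠ 0 :=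
  qPoch_ne_zero (self_mul_pow_ne_one hq) n

theorem summable_norm_mul_pow {q : ℂ} (hq : ‖q‖ < 1) (a : ℂ) :
    Summable fun i : ℕ => ‖-(a * q ^ i)‖ := by
  simp only [norm_neg, norm_mul, norm_pow]
  exact (summable_geometric_of_lt_one (norm_nonneg q) hq).mul_left _

theorem multipliable_one_sub_mul_pow {q : ℂ} (hq : ‖q‖ < 1) (a : ℂ) :
    Multipliable fun i : ℕ => 1 - a * q ^ i := by
  simpa [sub_eq_add_neg] using multipliable_one_add_of_summable (summable_norm_mul_pow hq a)

theorem tendsto_qPoch {q : ℂ} (hq : ‖q‖ < 1) (a : ℂ) :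
    Tendsto (qPoch a q) atTop (𝓝 (qPochInf a q)) :=
  (multipliable_one_sub_mul_pow hq a).tendsto_prod_tprod_nat

theorem qPochInf_ne_zero {a q : ℂ} (hq : ‖q‖ < 1) (h : ∀ i : ℕ, a * q ^ i ≠ 1) :
    qPochInf a q ≠ 0 := by
  have := tprod_one_add_ne_zero_of_summable (f := fun i : ℕ => -(a * q ^ i))
    (fun i => by simpa [← sub_eq_add_neg] using sub_ne_zero.2 (h i).symm)
    (summable_norm_mul_pow hq a)
  simpa [qPochInf, sub_eq_add_neg] using this

theorem qPochInf_eq_mul {q : ℂ} (hq : ‖q‖ < 1) (a : ℂ) (n : ℕ) :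
    qPochInf a q = qPoch a q n * qPochInf (a * q ^ n) q := by
  refine tendsto_nhds_unique ((tendsto_qPoch hq a).comp (tendsto_add_atTop_nat n)) ?_
  refine ((tendsto_qPoch hq (a * q ^ n)).const_mul (qPoch a q n)).congr fun m => ?_
  simp [Function.comp, add_comm m n, qPoch_add]

theorem exists_norm_le_of_tendsto {f : ℕ → ℂ} {l : ℂ} (h : Tendsto f atTop (𝓝 l)) :
    ∃ C : ℝ, 0 < C ∧ ∀ n, ‖f n‖ ≤ C := by
  obtain ⟨C, hC⟩ := (Metric.isBounded_range_of_tendsto f h).exists_norm_le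
  refine ⟨max C 1, by positivity, fun n => (hC _ ⟨n, rfl⟩).trans (le_max_left _ _)⟩

theorem exists_norm_qPoch_le {q : ℂ} (hq : ‖q‖ < 1) (a : ℂ) :
    ∃ C : ℝ, 0 < C ∧ ∀ n, ‖qPoch a q n‖ ≤ C :=
  exists_norm_le_of_tendsto (tendsto_qPoch hq a)

theorem exists_norm_inv_qPoch_le {a q : ℂ} (hq : ‖q‖ < 1) (h : ∀ i : ℕ, a * q ^ i ≠ 1) :
    ∃ C : ℝ, 0 < C ∧ ∀ n, ‖(qPoch a q n)⁻¹‖ ≤ C :=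
  exists_norm_le_of_tendsto ((tendsto_qPoch hq a).inv₀ (qPochInf_ne_zero hq h))

/-! ### Gaussian-type series -/

theorem summable_pow_choose_two {r : ℝ} (hr : 0 ≤ r) (hr1 : r < 1) {x : ℝ} (hx : 0 ≤ x) :
    Summable fun n : ℕ => r ^ n.choose 2 * x ^ n := by
  have h0 : Tendsto (fun n : ℕ => r ^ n * x) atTop (𝓝 0) := by
    simpa using (tendsto_pow_atTop_nhds_zero_of_lt_one hr hr1).mul_const x
  refine summable_of_ratio_norm_eventually_le (r := 1 / 2) (by norm_num) ?_
  filter_upwards [h0.eventually (gt_mem_nhds (by norm_num : (0 : ℝ) < 1 / 2))] with n hn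
  rw [Real.norm_of_nonneg (by positivity), Real.norm_of_nonneg (by positivity), choose_two_succ]
  calc r ^ (n + n.choose 2) * x ^ (n + 1) = (r ^ n * x) * (r ^ n.choose 2 * x ^ n) := by ring
    _ ≤ _ := by gcongr

/-- The coefficient of `x^n` in Euler's expansion of `(x;q)_∞`. -/
noncomputable def eulerCoeff (q : ℂ) (n : ℕ) : ℂ := (-1) ^ n * q ^ n.choose 2 * (qPoch q q n)⁻¹

theorem summable_norm_eulerCoeff {q : ℂ} (hq : ‖q‖ < 1) (x : ℂ) :
    Summable fun n : ℕ => ‖eulerCoeff q n * x ^ n‖ := by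
  obtain ⟨C, hC, h⟩ := exists_norm_inv_qPoch_le hq (self_mul_pow_ne_one hq)
  refine Summable.of_nonneg_of_le (fun _ => norm_nonneg _) (fun n => ?_)
    ((summable_pow_choose_two (norm_nonneg q) hq (norm_nonneg x)).mul_left C)
  simp only [eulerCoeff, norm_mul, norm_pow, norm_neg, norm_one, one_pow, one_mul]
  calc ‖q‖ ^ n.choose 2 * ‖(qPoch q q n)⁻¹‖ * ‖x‖ ^ n
      ≤ ‖q‖ ^ n.choose 2 * C * ‖x‖ ^ n := by gcongr; exact h n
    _ = _ := by ring

theorem eulerCoeff_zero (q : ℂ) : eulerCoeff q 0 = 1 := by simp [eulerCoeff, qPoch_zero]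

theorem eulerCoeff_succ {q : ℂ} (hq : ‖q‖ < 1) (n : ℕ) :
    eulerCoeff q (n + 1) * (1 - q ^ (n + 1)) = -(q ^ n * eulerCoeff q n) := by
  have h1 := qPoch_self_ne_zero hq n
  have h2 : 1 - q * q ^ n ≠ 0 := sub_ne_zero.2 (self_mul_pow_ne_one hq n).symm
  rw [eulerCoeff, eulerCoeff, qPoch_succ, choose_two_succ, pow_succ' q n]
  field_simp
  ring

/-- **Euler's expansion** of the infinite `q`-shifted factorial. -/
theorem hasSum_eulerCoeff {q : ℂ} (hq : ‖q‖ < 1) (x : ℂ) :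
    HasSum (fun n : ℕ => eulerCoeff q n * x ^ n) (qPochInf x q) := by
  have hs : ∀ y, Summable fun n : ℕ => eulerCoeff q n * y ^ n :=
    fun y => (summable_norm_eulerCoeff hq y).of_norm
  set F : ℂ → ℂ := fun y => ∑' n : ℕ, eulerCoeff q n * y ^ n with hF
  have hfun : ∀ y, F y = (1 - y) * F (y * q) := by
    intro y
    have e : ∀ n : ℕ, eulerCoeff q (n + 1) * y ^ (n + 1)
        = eulerCoeff q (n + 1) * (y * q) ^ (n + 1)
          - y * (eulerCoeff q n * (y * q) ^ n) := by
      intro n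
      have := eulerCoeff_succ hq n
      rw [mul_pow, mul_pow]
      linear_combination y ^ (n + 1) * this
    have h1 := (hs y).tsum_eq_zero_add
    have h2 := (hs (y * q)).tsum_eq_zero_add
    have h3 : ∑' n : ℕ, eulerCoeff q (n + 1) * y ^ (n + 1)
        = ∑' n : ℕ, eulerCoeff q (n + 1) * (y * q) ^ (n + 1) - y * F (y * q) := by
      rw [hF, ← tsum_mul_left, ← Summable.tsum_sub]
      · exact tsum_congr e
      · exact (summable_nat_add_iff 1).2 (hs (y * q))
      · exact (hs (y * q)).mul_left y
    simp only [hF] at h3 ⊢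
    rw [h1, h3]
    simp only [pow_zero] at h2 ⊢
    linear_combination -h2
  have hiter : ∀ n, F x = qPoch x q n * F (x * q ^ n) := by
    intro n
    induction n with
    | zero => simp [qPoch_zero]
    | succ n ih => rw [ih, hfun (x * q ^ n), qPoch_succ, pow_succ]; ring_nf
  have hlim : Tendsto (fun n : ℕ => F (x * q ^ n)) atTop (𝓝 1) := by
    have : Tendsto (fun n : ℕ => F (x * q ^ n)) atTop
        (𝓝 (∑' i : ℕ, if i = 0 then (1 : ℂ) else 0)) := by
      refine tendsto_tsum_of_dominated_convergence (summable_norm_eulerCoeff hq x) ?_ ?_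
      · intro i
        rcases Nat.eq_zero_or_pos i with rfl | hi
        · simp [eulerCoeff_zero]
        · rw [if_neg hi.ne']
          have h1 : Tendsto (fun n : ℕ => x * q ^ n) atTop (𝓝 0) := by
            simpa using (tendsto_pow_atTop_nhds_zero_of_norm_lt_one hq).const_mul x
          simpa [hi.ne'] using (h1.pow i).const_mul (eulerCoeff q i)
      · refine Eventually.of_forall fun n i => ?_
        rw [norm_mul, norm_mul, norm_pow, norm_pow, norm_mul, norm_pow]
        gcongr
        exact mul_le_of_le_one_right (norm_nonneg x) (pow_le_one₀ (norm_nonneg q) hq.le)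
    simpa using this
  have hmul : Tendsto (fun n => qPoch x q n * F (x * q ^ n)) atTop (𝓝 (qPochInf x q * 1)) :=
    (tendsto_qPoch hq x).mul hlim
  have heq : F x = qPochInf x q := by
    rw [mul_one] at hmul
    exact tendsto_nhds_unique (tendsto_const_nhds.congr fun n => hiter n) hmul
  rw [← heq]
  exact (hs x).hasSum

/-- The finite **`q`-binomial theorem**. -/
theorem sum_eulerCoeff_div {q : ℂ} (hq : ‖q‖ < 1) (x : ℂ) (n : ℕ) :
    ∑ p ∈ antidiagonal n, eulerCoeff q p.1 * x ^ p.1 * (qPoch q q p.2)⁻¹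
      = qPoch x q n * (qPoch q q n)⁻¹ := by
  induction n generalizing x with
  | zero => simp [eulerCoeff_zero, qPoch_zero]
  | succ n ih =>
    have hn : 1 - q ^ (n + 1) ≠ 0 := sub_ne_zero.2 (pow_succ_ne_one hq n).symm
    apply mul_left_cancel₀ hn
    have hrec : ∀ k : ℕ, (1 - q ^ (k + 1)) * (qPoch q q (k + 1))⁻¹ = (qPoch q q k)⁻¹ := by
      intro k
      have h1 := qPoch_self_ne_zero hq k
      have h2 : 1 - q * q ^ k ≠ 0 := sub_ne_zero.2 (self_mul_pow_ne_one hq k).symm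
      rw [qPoch_succ, pow_succ']
      field_simp
    have split : (1 - q ^ (n + 1)) *
        ∑ p ∈ antidiagonal (n + 1), eulerCoeff q p.1 * x ^ p.1 * (qPoch q q p.2)⁻¹
        = ∑ p ∈ antidiagonal (n + 1),
            eulerCoeff q p.1 * (1 - q ^ p.1) * x ^ p.1 * (qPoch q q p.2)⁻¹
          + ∑ p ∈ antidiagonal (n + 1),
            eulerCoeff q p.1 * (x * q) ^ p.1 * ((1 - q ^ p.2) * (qPoch q q p.2)⁻¹) := by
      rw [mul_sum, ← sum_add_distrib]
      refine sum_congr rfl fun p hp => ?_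
      rw [← mem_antidiagonal.1 hp, pow_add, mul_pow]
      ring
    rw [split, Nat.sum_antidiagonal_succ, Nat.sum_antidiagonal_succ']
    simp only [pow_zero, sub_self, mul_zero, zero_mul, zero_add, hrec, ih (x * q)]
    have e : ∀ p ∈ antidiagonal n,
        eulerCoeff q (p.1 + 1) * (1 - q ^ (p.1 + 1)) * x ^ (p.1 + 1) * (qPoch q q p.2)⁻¹
          = -x * (eulerCoeff q p.1 * (x * q) ^ p.1 * (qPoch q q p.2)⁻¹) := by
      intro p _
      rw [eulerCoeff_succ hq, mul_pow]
      ring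
    rw [sum_congr rfl e, ← mul_sum, ih (x * q)]
    have h4 : qPoch x q (n + 1) = (1 - x) * qPoch (x * q) q n := by
      rw [add_comm n 1, qPoch_add, pow_one]; simp [qPoch]
    rw [h4]
    linear_combination -(1 - x) * qPoch (x * q) q n * hrec n

/-! ### The conjugate Bailey pair -/

theorem hasSum_of_eq {ι : Type*} {f g : ι → ℂ} {a b : ℂ} (h : HasSum f a) (hfg : ∀ i, g i = f i)
    (hab : b = a) : HasSum g b := by
  rw [hab, funext hfg]; exact h

theorem hasSum_antidiagonal {f : ℕ × ℕ → ℂ} {s : ℂ} (h : HasSum f s) :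
    HasSum (fun n => ∑ p ∈ antidiagonal n, f p) s := by
  rw [← HasAntidiagonal.sigmaAntidiagonalEquivProd.hasSum_iff] at h
  exact hasSum_of_eq (h.sigma fun n => hasSum_fintype _)
    (fun n => (sum_finset_coe f (antidiagonal n)).symm) rfl

/-- Differences and minima give a bijection between pairs of natural numbers and `ℤ × ℕ`. -/
def diffMinEquiv : ℕ × ℕ ≃ ℤ × ℕ where
  toFun p := ((p.1 : ℤ) - p.2, min p.1 p.2)
  invFun p := (p.2 + p.1.toNat, p.2 + (-p.1).toNat)
  left_inv p := by ext <;> simp only <;> omega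
  right_inv p := by ext <;> simp only <;> omega

theorem sum_eulerCoeff_mul_pow_eq_zero {q : ℂ} (hq : ‖q‖ < 1) (i n : ℕ) (h : i < n) :
    ∑ p ∈ antidiagonal n, eulerCoeff q p.1 * ((qPoch q q p.2)⁻¹ * (q ^ p.2) ^ i) = 0 := by
  induction i generalizing n with
  | zero =>
    have := sum_eulerCoeff_div hq 1 n
    have h0 : qPoch 1 q n = 0 := by
      obtain ⟨n, rfl⟩ := Nat.exists_eq_succ_of_ne_zero h.ne'
      exact prod_eq_zero (mem_range.2 n.succ_pos) (by simp)
    simpa [h0] using this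
  | succ i ih =>
    obtain ⟨n, rfl⟩ : ∃ k, n = k + 1 := ⟨n - 1, by omega⟩
    have hrec : ∀ k : ℕ, (qPoch q q (k + 1))⁻¹ * (1 - q ^ (k + 1)) = (qPoch q q k)⁻¹ := by
      intro k
      have h1 := qPoch_self_ne_zero hq k
      have h2 : 1 - q * q ^ k ≠ 0 := sub_ne_zero.2 (self_mul_pow_ne_one hq k).symm
      rw [qPoch_succ, pow_succ']
      field_simp
    have e : ∑ p ∈ antidiagonal (n + 1), eulerCoeff q p.1 * ((qPoch q q p.2)⁻¹ * (q ^ p.2) ^ i)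
        - ∑ p ∈ antidiagonal (n + 1),
            eulerCoeff q p.1 * ((qPoch q q p.2)⁻¹ * (q ^ p.2) ^ (i + 1))
        = q ^ i * ∑ p ∈ antidiagonal n,
            eulerCoeff q p.1 * ((qPoch q q p.2)⁻¹ * (q ^ p.2) ^ i) := by
      rw [← sum_sub_distrib, Nat.sum_antidiagonal_succ', mul_sum]
      simp only [pow_zero, one_pow, sub_self, zero_add]
      refine sum_congr rfl fun p _ => ?_
      rw [← hrec p.2]
      ring
    rw [ih (n + 1) (by omega), ih n (by omega)] at e
    simpa using e

theorem sum_eulerCoeff_mul_qPoch_eq_zero {q : ℂ} (hq : ‖q‖ < 1) (a : ℂ) (n : ℕ) :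
    ∑ p ∈ antidiagonal (n + 1),
      eulerCoeff q p.1 * ((qPoch q q p.2)⁻¹ * qPoch (a * q ^ p.2) q n) = 0 := by
  have hn := qPoch_self_ne_zero hq n
  have e : ∀ x, qPoch x q n = ∑ i ∈ antidiagonal n,
      qPoch q q n * (eulerCoeff q i.1 * x ^ i.1 * (qPoch q q i.2)⁻¹) := by
    intro x
    rw [← mul_sum, sum_eulerCoeff_div hq]
    field_simp
  have e2 : ∀ p ∈ antidiagonal (n + 1),
      eulerCoeff q p.1 * ((qPoch q q p.2)⁻¹ * qPoch (a * q ^ p.2) q n)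
      = ∑ i ∈ antidiagonal n, qPoch q q n * (eulerCoeff q i.1 * a ^ i.1 * (qPoch q q i.2)⁻¹)
        * (eulerCoeff q p.1 * ((qPoch q q p.2)⁻¹ * (q ^ p.2) ^ i.1)) := by
    intro p _
    rw [e, mul_sum, mul_sum]
    refine sum_congr rfl fun i _ => ?_
    rw [mul_pow]; ring
  rw [sum_congr rfl e2, sum_comm]
  refine sum_eq_zero fun i hi => ?_
  rw [← mul_sum, sum_eulerCoeff_mul_pow_eq_zero hq, mul_zero]
  have := mem_antidiagonal.1 hi
  omega

theorem sum_eulerCoeff_mul_qPoch_div {q : ℂ} (hq : ‖q‖ < 1) (m n : ℕ) :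
    ∑ p ∈ antidiagonal n, eulerCoeff q p.1 *
      ((qPoch q q p.2)⁻¹ * (qPoch q q (2 * m + p.2 + 1))⁻¹ * qPoch q q (2 * m + n + p.2))
      = if n = 0 then (1 - q ^ (2 * m + 1))⁻¹ else 0 := by
  rcases n with _ | n
  · have h1 := qPoch_self_ne_zero hq (2 * m)
    have h2 : 1 - q * q ^ (2 * m) ≠ 0 := sub_ne_zero.2 (self_mul_pow_ne_one hq _).symm
    simp only [Nat.antidiagonal_zero, sum_singleton, eulerCoeff_zero, qPoch_zero, add_zero, if_true,
      qPoch_succ, pow_succ']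
    field_simp
  · rw [if_neg n.succ_ne_zero, ← sum_eulerCoeff_mul_qPoch_eq_zero hq (q ^ (2 * m + 2)) n]
    refine sum_congr rfl fun p _ => ?_
    have h1 := qPoch_self_ne_zero hq (2 * m + p.2 + 1)
    rw [show 2 * m + (n + 1) + p.2 = (2 * m + p.2 + 1) + n by ring, qPoch_add _ _ _ n,
      show q * q ^ (2 * m + p.2 + 1) = q ^ (2 * m + 2) * q ^ p.2 by ring]
    field_simp

/-- The series `∑ (-1)^n q^{n(n-1)/2 + (j+1)n} (q;q)_{2r+n} / (q;q)_n`. -/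
noncomputable def thetaCoeff (q : ℂ) (r j : ℕ) : ℂ :=
  ∑' n : ℕ, eulerCoeff q n * (q ^ n) ^ (j + 1) * qPoch q q (2 * r + n)

theorem exists_norm_thetaCoeff_term_le {q : ℂ} (hq : ‖q‖ < 1) :
    ∃ C : ℝ, 0 < C ∧ ∀ r j n : ℕ,
      ‖eulerCoeff q n * (q ^ n) ^ (j + 1) * qPoch q q (2 * r + n)‖ ≤ C * ‖eulerCoeff q n‖ := by
  obtain ⟨C, hC, h⟩ := exists_norm_qPoch_le hq q
  refine ⟨C, hC, fun r j n => ?_⟩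
  rw [norm_mul, norm_mul]
  have h1 : ‖(q ^ n) ^ (j + 1)‖ ≤ 1 := by
    rw [norm_pow, norm_pow]; exact pow_le_one₀ (by positivity) (pow_le_one₀ (norm_nonneg _) hq.le)
  calc _ ≤ ‖eulerCoeff q n‖ * 1 * C := by gcongr; exact h _
    _ = _ := by ring

theorem summable_norm_eulerCoeff_one {q : ℂ} (hq : ‖q‖ < 1) :
    Summable fun n : ℕ => ‖eulerCoeff q n‖ := by
  simpa using summable_norm_eulerCoeff hq 1

theorem hasSum_thetaCoeff {q : ℂ} (hq : ‖q‖ < 1) (r j : ℕ) :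
    HasSum (fun n : ℕ => eulerCoeff q n * (q ^ n) ^ (j + 1) * qPoch q q (2 * r + n))
      (thetaCoeff q r j) := by
  obtain ⟨C, _, h⟩ := exists_norm_thetaCoeff_term_le hq
  exact (((summable_norm_eulerCoeff_one hq).mul_left C).of_norm_bounded (h r j)).hasSum

theorem exists_norm_thetaCoeff_le {q : ℂ} (hq : ‖q‖ < 1) :
    ∃ C : ℝ, 0 ≤ C ∧ ∀ r j : ℕ, ‖thetaCoeff q r j‖ ≤ C := by
  obtain ⟨C, hC, h⟩ := exists_norm_thetaCoeff_term_le hq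
  refine ⟨_, tsum_nonneg fun n => by positivity, fun r j =>
    tsum_of_norm_bounded ((summable_norm_eulerCoeff_one hq).mul_left C).hasSum (h r j)⟩

theorem hasSum_eulerCoeff_mul_eulerCoeff {q : ℂ} (hq : ‖q‖ < 1) (r j : ℕ) :
    HasSum (fun b : ℕ => qPoch q q (2 * r) * qPochInf q q *
        (eulerCoeff q b * eulerCoeff q (b + j) * q ^ ((r + 1) * (2 * b + j))))
      ((-1) ^ j * q ^ ((j + 1).choose 2 + r * j) * thetaCoeff q r j) := by
  set D : ℂ := (-1) ^ j * q ^ ((j + 1).choose 2 + r * j) with hD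
  set f : ℕ × ℕ → ℂ := fun p => D * qPoch q q (2 * r) *
    ((-1) ^ p.1 * eulerCoeff q p.1 * q ^ (p.1.choose 2 + p.1 * (2 + j + 2 * r))
      * (eulerCoeff q p.2 * (q ^ (p.1 + j + 1)) ^ p.2)) with hf
  have hsum : Summable f := by
    refine Summable.mul_left _ (Summable.of_norm_bounded
      (((summable_norm_eulerCoeff_one hq).mul_of_nonneg (summable_norm_eulerCoeff_one hq))
        (fun _ => norm_nonneg _) fun _ => norm_nonneg _) fun p => ?_)
    have h1 : ∀ k, ‖q ^ k‖ ≤ 1 := fun k => by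
      rw [norm_pow]; exact pow_le_one₀ (norm_nonneg _) hq.le
    rw [← pow_mul]
    simp only [norm_mul, norm_pow (-1 : ℂ), norm_neg, norm_one, one_pow, one_mul]
    calc _ ≤ ‖eulerCoeff q p.1‖ * 1 * (‖eulerCoeff q p.2‖ * 1) := by
          gcongr <;> exact h1 _
      _ = _ := by ring
  have hrow : ∀ b, HasSum (fun n => f (b, n)) (qPoch q q (2 * r) * qPochInf q q *
        (eulerCoeff q b * eulerCoeff q (b + j) * q ^ ((r + 1) * (2 * b + j)))) := by
    intro b
    have h1 := (hasSum_eulerCoeff hq (q ^ (b + j + 1))).mul_left (D * qPoch q q (2 * r) *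
      ((-1) ^ b * eulerCoeff q b * q ^ (b.choose 2 + b * (2 + j + 2 * r))))
    have hb := qPoch_self_ne_zero hq (b + j)
    refine hasSum_of_eq h1 (fun n => ?_) ?_
    · simp only [hf]; ring
    · rw [qPochInf_eq_mul hq q (b + j), pow_succ' q (b + j), eulerCoeff, eulerCoeff, hD,
        choose_two_add, choose_two_succ]
      field_simp
      ring
  have hdiag := hasSum_antidiagonal hsum.hasSum
  have hval : ∀ M, ∑ p ∈ antidiagonal M, f p
      = D * (eulerCoeff q M * (q ^ M) ^ (j + 1) * qPoch q q (2 * r + M)) := by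
    intro M
    have e : ∀ p ∈ antidiagonal M, f p = D * qPoch q q (2 * r) *
        ((-1) ^ M * q ^ M.choose 2 * (q ^ M) ^ (j + 1)) *
        (eulerCoeff q p.1 * (q ^ (2 * r + 1)) ^ p.1 * (qPoch q q p.2)⁻¹) := by
      intro p hp
      rw [← mem_antidiagonal.1 hp, choose_two_add]
      simp only [hf]
      rw [eulerCoeff.eq_1 q p.2]
      ring
    rw [sum_congr rfl e, ← mul_sum, sum_eulerCoeff_div hq, qPoch_add, eulerCoeff, pow_succ' q (2 * r)]
    ring
  simp only [hval] at hdiag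
  have hV := (hasSum_thetaCoeff hq r j).mul_left D
  rw [← hdiag.unique hV]
  exact hsum.hasSum.prod_fiberwise hrow

/-- A Laurent expansion of `(q;q)_∞ (zq^{r+1};q)_∞ (z⁻¹q^{r+1};q)_∞`, which for `r = 0` is a form
of Jacobi's triple product identity. -/
theorem hasSum_triple_product {q z : ℂ} (hq : ‖q‖ < 1) (hz : z ≠ 0) (r : ℕ) :
    HasSum (fun j : ℤ => z ^ j * ((-1) ^ j.natAbs *
        q ^ ((j.natAbs + 1).choose 2 + r * j.natAbs) * thetaCoeff q r j.natAbs))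
      (qPoch q q (2 * r) * qPochInf q q *
        (qPochInf (z * q ^ (r + 1)) q * qPochInf (z⁻¹ * q ^ (r + 1)) q)) := by
  have h := (summable_mul_of_summable_norm (summable_norm_eulerCoeff hq (z * q ^ (r + 1)))
    (summable_norm_eulerCoeff hq (z⁻¹ * q ^ (r + 1))))
  have h2 := ((hasSum_eulerCoeff hq (z * q ^ (r + 1))).mul
    (hasSum_eulerCoeff hq (z⁻¹ * q ^ (r + 1))) h).mul_left (qPoch q q (2 * r) * qPochInf q q)
  rw [← diffMinEquiv.symm.hasSum_iff] at h2
  refine h2.prod_fiberwise fun j => ?_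
  have hz' : ∀ n : ℕ, z ^ n * z⁻¹ ^ n = 1 := fun n => by
    rw [← mul_pow, mul_inv_cancel₀ hz, one_pow]
  refine hasSum_of_eq ((hasSum_eulerCoeff_mul_eulerCoeff hq r j.natAbs).mul_left (z ^ j))
    (fun b => ?_) rfl
  simp only [Function.comp, diffMinEquiv, Equiv.coe_fn_symm_mk]
  rcases le_total 0 j with hj | hj
  · obtain ⟨i, rfl⟩ := Int.eq_ofNat_of_zero_le hj
    have h1 : (-(i : ℤ)).toNat = 0 := by omega
    simp only [Int.toNat_natCast, Int.natAbs_natCast, h1, zpow_natCast, add_zero]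
    linear_combination (qPoch q q (2 * r) * qPochInf q q * eulerCoeff q b * eulerCoeff q (b + i)
      * z ^ i * q ^ ((r + 1) * (2 * b + i))) * hz' b
  · obtain ⟨i, rfl⟩ := Int.exists_eq_neg_ofNat hj
    have h1 : (-(i : ℤ)).toNat = 0 := by omega
    simp only [neg_neg, Int.toNat_natCast, Int.natAbs_neg, Int.natAbs_natCast, h1, zpow_neg,
      zpow_natCast, add_zero]
    rw [← inv_pow]
    linear_combination (qPoch q q (2 * r) * qPochInf q q * eulerCoeff q b * eulerCoeff q (b + i)
      * z⁻¹ ^ i * q ^ ((r + 1) * (2 * b + i))) * hz' b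

theorem hasSum_thetaCoeff_div {q : ℂ} (hq : ‖q‖ < 1) (m j : ℕ) :
    HasSum (fun s : ℕ => (q ^ (m + s)) ^ (j + 1) * ((qPoch q q s)⁻¹ *
        (qPoch q q (2 * m + s + 1))⁻¹) * thetaCoeff q (m + s) j)
      ((q ^ m) ^ (j + 1) * (1 - q ^ (2 * m + 1))⁻¹) := by
  obtain ⟨C, hC, hbd⟩ := exists_norm_thetaCoeff_term_le hq
  obtain ⟨K, hK, hK'⟩ := exists_norm_inv_qPoch_le hq (self_mul_pow_ne_one hq)
  set f : ℕ × ℕ → ℂ := fun p => (q ^ (m + p.2)) ^ (j + 1) * ((qPoch q q p.2)⁻¹ *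
        (qPoch q q (2 * m + p.2 + 1))⁻¹) *
        (eulerCoeff q p.1 * (q ^ p.1) ^ (j + 1) * qPoch q q (2 * (m + p.2) + p.1)) with hf
  have hsum : Summable f := by
    refine Summable.of_norm_bounded
      (((summable_norm_eulerCoeff_one hq).mul_left C).mul_of_nonneg
        ((summable_geometric_of_lt_one (norm_nonneg q) hq).mul_left (K * K))
        (fun _ => by positivity) fun _ => by positivity) fun p => ?_
    have h1 : ‖(q ^ (m + p.2)) ^ (j + 1)‖ ≤ ‖q‖ ^ p.2 := by
      rw [← pow_mul, norm_pow]
      exact pow_le_pow_of_le_one (norm_nonneg q) hq.le (by nlinarith)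
    simp only [hf]
    rw [norm_mul, norm_mul, norm_mul (qPoch q q p.2)⁻¹]
    calc _ ≤ ‖q‖ ^ p.2 * (K * K) * (C * ‖eulerCoeff q p.1‖) := by
          gcongr
          · exact hK' _
          · exact hK' _
          · exact hbd _ _ _
      _ = _ := by ring
  have hdiag := hasSum_antidiagonal hsum.hasSum
  have hval : ∀ M, ∑ p ∈ antidiagonal M, f p
      = if M = 0 then (q ^ m) ^ (j + 1) * (1 - q ^ (2 * m + 1))⁻¹ else 0 := by
    intro M
    have e : ∀ p ∈ antidiagonal M, f p = (q ^ (m + M)) ^ (j + 1) * (eulerCoeff q p.1 *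
      ((qPoch q q p.2)⁻¹ * (qPoch q q (2 * m + p.2 + 1))⁻¹ * qPoch q q (2 * m + M + p.2))) := by
      intro p hp
      rw [← mem_antidiagonal.1 hp]
      simp only [hf]
      rw [show 2 * (m + p.2) + p.1 = 2 * m + (p.1 + p.2) + p.2 by ring]
      ring
    rw [sum_congr rfl e, ← mul_sum, sum_eulerCoeff_mul_qPoch_div hq]
    split_ifs with h
    · subst h; simp
    · simp
  simp only [hval] at hdiag
  have h0 := hdiag.unique (hasSum_ite_eq 0 _)
  rw [← h0]
  rw [← (Equiv.prodComm ℕ ℕ).summable_iff] at hsum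
  have h3 := (hsum.hasSum).prod_fiberwise fun s =>
    ((hasSum_thetaCoeff hq (m + s) j).mul_left ((q ^ (m + s)) ^ (j + 1) * ((qPoch q q s)⁻¹ *
        (qPoch q q (2 * m + s + 1))⁻¹)))
  rwa [← (Equiv.prodComm ℕ ℕ).tsum_eq f]

theorem summable_zpow_mul_pow_choose_two {r x : ℝ} (hr : 0 ≤ r) (hr1 : r < 1) (hx : 0 < x) :
    Summable fun j : ℤ => x ^ j * r ^ (j.natAbs + 1).choose 2 := by
  have key : ∀ y : ℝ, 0 < y → Summable fun n : ℕ => y ^ n * r ^ (n + 1).choose 2 := by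
    intro y hy
    refine (summable_pow_choose_two hr hr1 (mul_nonneg hr hy.le)).congr fun n => ?_
    rw [choose_two_succ]; ring
  refine Summable.of_nat_of_neg ?_ ?_
  · simpa using key x hx
  · simpa using key x⁻¹ (inv_pos.2 hx)

/-- The conjugate Bailey pair relative to `q` behind the universal identity. -/
theorem hasSum_conjugate_bailey {q z : ℂ} (hq : ‖q‖ < 1) (hz : z ≠ 0)
    (hz₁ : ∀ i : ℕ, z * q * q ^ i ≠ 1) (hz₂ : ∀ i : ℕ, z⁻¹ * q * q ^ i ≠ 1) (m : ℕ) :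
    HasSum (fun j : ℤ => z ^ j * ((-1) ^ j.natAbs * q ^ (j.natAbs + 1).choose 2 *
        ((q ^ m) ^ (j.natAbs + 1) * (1 - q ^ (2 * m + 1))⁻¹)))
      (∑' s : ℕ, qPochInf (z * q) q * qPochInf (z⁻¹ * q) q * qPochInf q q *
        (qPoch q q (2 * (m + s)) * q ^ (m + s) /
          (qPoch (z * q) q (m + s) * qPoch (z⁻¹ * q) q (m + s)) *
          ((qPoch q q s)⁻¹ * (qPoch q q (2 * m + s + 1))⁻¹))) := by
  obtain ⟨C, hC, hbd⟩ := exists_norm_thetaCoeff_le hq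
  obtain ⟨K, hK, hK'⟩ := exists_norm_inv_qPoch_le hq (self_mul_pow_ne_one hq)
  set c : ℕ → ℂ := fun s => q ^ (m + s) * ((qPoch q q s)⁻¹ * (qPoch q q (2 * m + s + 1))⁻¹) with hc
  set f : ℕ × ℤ → ℂ := fun p => c p.1 * (z ^ p.2 * ((-1) ^ p.2.natAbs *
        q ^ ((p.2.natAbs + 1).choose 2 + (m + p.1) * p.2.natAbs) *
          thetaCoeff q (m + p.1) p.2.natAbs)) with hf
  have hsum : Summable f := by
    refine Summable.of_norm_bounded
      (((summable_geometric_of_lt_one (norm_nonneg q) hq).mul_left (K * K)).mul_of_nonneg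
        ((summable_zpow_mul_pow_choose_two (norm_nonneg q) hq (norm_pos_iff.2 hz)).mul_left C)
        (fun _ => by positivity) fun _ => by positivity) fun p => ?_
    have h1 : ‖q ^ (m + p.1)‖ ≤ ‖q‖ ^ p.1 := by
      rw [norm_pow]
      exact pow_le_pow_of_le_one (norm_nonneg q) hq.le (by omega)
    have h2 : ‖q ^ ((p.2.natAbs + 1).choose 2 + (m + p.1) * p.2.natAbs)‖
        ≤ ‖q‖ ^ (p.2.natAbs + 1).choose 2 := by
      rw [norm_pow]
      exact pow_le_pow_of_le_one (norm_nonneg q) hq.le (by omega)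
    simp only [hf, hc]
    simp only [norm_mul, norm_zpow, norm_pow (-1 : ℂ), norm_neg, norm_one, one_pow, one_mul]
    calc _ ≤ ‖q‖ ^ p.1 * (K * K) *
          (‖z‖ ^ p.2 * (‖q‖ ^ (p.2.natAbs + 1).choose 2 * C)) := by
          gcongr
          · exact hK' _
          · exact hK' _
          · exact hbd _ _
      _ = _ := by ring
  have hrow : ∀ s, HasSum (fun j => f (s, j)) (qPochInf (z * q) q * qPochInf (z⁻¹ * q) q *
      qPochInf q q * (qPoch q q (2 * (m + s)) * q ^ (m + s) /
          (qPoch (z * q) q (m + s) * qPoch (z⁻¹ * q) q (m + s)) *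
          ((qPoch q q s)⁻¹ * (qPoch q q (2 * m + s + 1))⁻¹))) := by
    intro s
    refine hasSum_of_eq ((hasSum_triple_product hq hz (m + s)).mul_left (c s)) (fun _ => rfl) ?_
    have e1 := qPoch_ne_zero hz₁ (m + s)
    have e2 := qPoch_ne_zero hz₂ (m + s)
    rw [qPochInf_eq_mul hq (z * q) (m + s), qPochInf_eq_mul hq (z⁻¹ * q) (m + s), hc,
      pow_succ' q (m + s), ← mul_assoc z, ← mul_assoc z⁻¹]
    generalize qPoch (z * q) q (m + s) = u at *
    generalize qPoch (z⁻¹ * q) q (m + s) = v at *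
    field_simp
  rw [(hsum.hasSum.prod_fiberwise hrow).tsum_eq]
  rw [← (Equiv.prodComm ℤ ℕ).summable_iff] at hsum
  rw [← (Equiv.prodComm ℤ ℕ).tsum_eq f]
  refine hsum.hasSum.prod_fiberwise fun j => ?_
  refine hasSum_of_eq ((hasSum_thetaCoeff_div hq m j.natAbs).mul_left
    (z ^ j * ((-1) ^ j.natAbs * q ^ (j.natAbs + 1).choose 2))) (fun s => ?_) ?_
  · simp only [Function.comp, Equiv.prodComm_apply, Prod.swap, hf, hc]
    ring
  · ring

/-! ### Bailey pairs -/

theorem recipQPochSub_add (q : ℂ) (m d : ℕ) :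
    recipQPochSub q (m + d) m = (qPoch q q d)⁻¹ := by
  simp [recipQPochSub]

theorem recipQPochSub_of_lt (q : ℂ) {n m : ℕ} (h : n < m) : recipQPochSub q n m = 0 := by
  simp [recipQPochSub, h]

theorem inv_qPoch_self_succ {q : ℂ} (hq : ‖q‖ < 1) (k : ℕ) :
    (qPoch q q k)⁻¹ = (1 - q ^ (k + 1)) * (qPoch q q (k + 1))⁻¹ := by
  have h1 := qPoch_self_ne_zero hq k
  have h2 : 1 - q * q ^ k ≠ 0 := sub_ne_zero.2 (self_mul_pow_ne_one hq k).symm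
  rw [qPoch_succ, pow_succ']
  field_simp

/-- A limiting case of the **`q`-Vandermonde** sum. -/
theorem sum_pow_div_qPoch {q : ℂ} (hq : ‖q‖ < 1) (n c : ℕ) :
    ∑ p ∈ antidiagonal n, q ^ (p.1 * (p.1 + c)) *
        ((qPoch q q p.2)⁻¹ * ((qPoch q q p.1)⁻¹ * (qPoch q q (p.1 + c))⁻¹))
      = (qPoch q q n)⁻¹ * (qPoch q q (n + c))⁻¹ := by
  induction n generalizing c with
  | zero => simp [qPoch_zero]
  | succ n ih =>
    have hn : 1 - q ^ (n + 1) ≠ 0 := sub_ne_zero.2 (pow_succ_ne_one hq n).symm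
    apply mul_left_cancel₀ hn
    have split : (1 - q ^ (n + 1)) * ∑ p ∈ antidiagonal (n + 1), q ^ (p.1 * (p.1 + c)) *
        ((qPoch q q p.2)⁻¹ * ((qPoch q q p.1)⁻¹ * (qPoch q q (p.1 + c))⁻¹))
        = ∑ p ∈ antidiagonal (n + 1), q ^ (p.1 * (p.1 + c)) *
            ((qPoch q q p.2)⁻¹ * ((1 - q ^ p.1) * (qPoch q q p.1)⁻¹ * (qPoch q q (p.1 + c))⁻¹))
          + ∑ p ∈ antidiagonal (n + 1), q ^ (p.1 * (p.1 + c)) * q ^ p.1 *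
            ((1 - q ^ p.2) * (qPoch q q p.2)⁻¹ *
              ((qPoch q q p.1)⁻¹ * (qPoch q q (p.1 + c))⁻¹)) := by
      rw [mul_sum, ← sum_add_distrib]
      refine sum_congr rfl fun p hp => ?_
      rw [← mem_antidiagonal.1 hp, pow_add q p.1 p.2]
      ring
    rw [split, Nat.sum_antidiagonal_succ, Nat.sum_antidiagonal_succ']
    simp only [pow_zero, sub_self, mul_zero, zero_mul, zero_add,
      ← inv_qPoch_self_succ hq]
    rw [← mul_assoc, ← inv_qPoch_self_succ hq, show n + 1 + c = n + (c + 1) by ring, ← ih (c + 1),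
      ← sum_add_distrib]
    refine sum_congr rfl fun p _ => ?_
    rw [show p.1 + 1 + c = p.1 + c + 1 by ring, ← add_assoc p.1 c 1,
      inv_qPoch_self_succ hq (p.1 + c)]
    ring

theorem sum_pow_mul_recipQPochSub {q : ℂ} (hq : ‖q‖ < 1) {n m : ℕ} (h : m ≤ n) :
    ∑ r ∈ range (n + 1), q ^ (r ^ 2 + r) * recipQPochSub q n r *
        (recipQPochSub q r m * (qPoch q q (r + m + 1))⁻¹)
      = q ^ (m ^ 2 + m) * (recipQPochSub q n m * (qPoch q q (n + m + 1))⁻¹) := by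
  obtain ⟨d, rfl⟩ := Nat.exists_eq_add_of_le h
  rw [show m + d + 1 = m + (d + 1) by ring, sum_range_add, sum_eq_zero, zero_add, recipQPochSub_add,
    show m + d + m + 1 = d + (2 * m + 1) by ring, ← sum_pow_div_qPoch hq,
    Nat.sum_antidiagonal_eq_sum_range_succ_mk, mul_sum]
  · refine sum_congr rfl fun s hs => ?_
    have hs' : s ≤ d := Nat.lt_succ_iff.1 (mem_range.1 hs)
    obtain ⟨e, rfl⟩ := Nat.exists_eq_add_of_le hs'
    rw [recipQPochSub_add, ← add_assoc m s e, recipQPochSub_add, Nat.add_sub_cancel_left,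
      show m + s + m + 1 = s + (2 * m + 1) by ring]
    ring
  · intro r hr
    rw [recipQPochSub_of_lt q (mem_range.1 hr)]
    ring

/-- The sequence `β` that forms a Bailey pair relative to `q` with `a`, up to normalisation. -/
noncomputable def baileyBeta (q : ℂ) (a : ℕ → ℂ) (n : ℕ) : ℂ :=
  ∑ m ∈ range (n + 1), a m * (recipQPochSub q n m * (qPoch q q (n + m + 1))⁻¹)

theorem baileyBeta_eq_sum_of_le (q : ℂ) (a : ℕ → ℂ) {r n : ℕ} (h : r ≤ n) :
    baileyBeta q a r
      = ∑ m ∈ range (n + 1), a m * (recipQPochSub q r m * (qPoch q q (r + m + 1))⁻¹) := by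
  refine sum_subset (range_subset_range.2 (by omega)) fun m _ hm => ?_
  rw [recipQPochSub_of_lt q (by simpa using hm)]
  ring

/-- **Bailey's lemma** with both parameters sent to infinity. -/
theorem bailey_lemma {q : ℂ} (hq : ‖q‖ < 1) (a : ℕ → ℂ) (n : ℕ) :
    ∑ r ∈ range (n + 1), q ^ (r ^ 2 + r) * recipQPochSub q n r * baileyBeta q a r
      = baileyBeta q (fun m => q ^ (m ^ 2 + m) * a m) n := by
  have e : ∀ r ∈ range (n + 1), q ^ (r ^ 2 + r) * recipQPochSub q n r * baileyBeta q a r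
      = ∑ m ∈ range (n + 1), a m * (q ^ (r ^ 2 + r) * recipQPochSub q n r *
        (recipQPochSub q r m * (qPoch q q (r + m + 1))⁻¹)) := by
    intro r hr
    rw [baileyBeta_eq_sum_of_le q a (Nat.lt_succ_iff.1 (mem_range.1 hr)), mul_sum]
    exact sum_congr rfl fun m _ => by ring
  rw [sum_congr rfl e, sum_comm, baileyBeta]
  refine sum_congr rfl fun m hm => ?_
  rw [← mul_sum, sum_pow_mul_recipQPochSub hq (Nat.lt_succ_iff.1 (mem_range.1 hm))]
  ring

theorem norm_sq_lt_one {q : ℂ} (hq : ‖q‖ < 1) : ‖q ^ 2‖ < 1 := by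
  rw [norm_pow]; exact pow_lt_one₀ (norm_nonneg q) hq two_ne_zero

/-- The polynomial in the telescoping certificate for `seedPair`. -/
noncomputable def certPoly (q y x : ℂ) : ℂ :=
  y ^ 2 * q * (x ^ 4 - x⁻¹) + (x ^ 3 - 1) + (q⁻¹ - y ^ 2 * q ^ 2) * (x - x ^ 2)

theorem certPoly_identity {q x d : ℂ} (hq : q ≠ 0) (_hx : x ≠ 0) {y : ℂ} (hy : y = x * d / q) :
    (1 - x ^ 4 * q ^ 2) * ((1 + y ^ 2 * q) * (1 - y ^ 4 * q ^ 4)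
        + y ^ 2 / q * ((1 - d ^ 2) * (1 - y ^ 2 * x ^ 2 * q ^ 4)))
      = -(x / q) * certPoly q y (x * q) * (1 - d ^ 2)
        - certPoly q y x * (1 - y ^ 2 * x ^ 2 * q ^ 4) := by
  subst hy
  unfold certPoly
  field_simp
  ring

/-- The sequence `(-1)^m q^{(m²-3m)/2} (1 - q^{4m+2})`. -/
noncomputable def seedAlpha (q : ℂ) (m : ℕ) : ℂ :=
  (1 - q ^ (4 * m + 2)) * ((-1) ^ m * q ^ m.choose 2 * (q ^ m)⁻¹)

theorem seedBeta_recurrence {q : ℂ} (hq : ‖q‖ < 1) (h0 : q ≠ 0) (n : ℕ) :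
    (1 + q ^ (2 * n + 1)) * (1 - q ^ (4 * n + 4)) * baileyBeta (q ^ 2) (seedAlpha q) (n + 1)
      + q ^ (2 * n) / q * baileyBeta (q ^ 2) (seedAlpha q) n = 0 := by
  have hQ := norm_sq_lt_one hq
  set w : ℕ → ℂ := fun m => (-1) ^ m * q ^ m.choose 2 * (q ^ m)⁻¹ with hw
  set G : ℕ → ℂ := fun m => w m * certPoly q (q ^ n) (q ^ m) *
    (recipQPochSub (q ^ 2) (n + 1) m * (qPoch (q ^ 2) (q ^ 2) (n + m + 1))⁻¹) with hG
  have hterm : ∀ m ∈ range (n + 1 + 1),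
      (1 + q ^ (2 * n + 1)) * (1 - q ^ (4 * n + 4)) * (seedAlpha q m *
          (recipQPochSub (q ^ 2) (n + 1) m * (qPoch (q ^ 2) (q ^ 2) (n + 1 + m + 1))⁻¹))
        + q ^ (2 * n) / q * (seedAlpha q m *
          (recipQPochSub (q ^ 2) n m * (qPoch (q ^ 2) (q ^ 2) (n + m + 1))⁻¹))
        = G (m + 1) - G m := by
    intro m hm
    obtain ⟨d, hd⟩ := Nat.exists_eq_add_of_le (Nat.lt_succ_iff.1 (mem_range.1 hm))
    have hw' : w (m + 1) = -(q ^ m / q) * w m := by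
      simp only [hw]
      rw [choose_two_succ]
      field_simp
      ring
    have r1 : recipQPochSub (q ^ 2) (n + 1) m = (qPoch (q ^ 2) (q ^ 2) d)⁻¹ := by
      rw [hd, recipQPochSub_add]
    have r2 : recipQPochSub (q ^ 2) n m
        = (1 - (q ^ d) ^ 2) * (qPoch (q ^ 2) (q ^ 2) d)⁻¹ := by
      rcases d with _ | d
      · rw [recipQPochSub_of_lt _ (by omega)]; simp
      · rw [show n = m + d by omega, recipQPochSub_add, inv_qPoch_self_succ hQ d]; ring
    have r3 : recipQPochSub (q ^ 2) (n + 1) (m + 1)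
        = (1 - (q ^ d) ^ 2) * (qPoch (q ^ 2) (q ^ 2) d)⁻¹ := by
      rcases d with _ | d
      · rw [recipQPochSub_of_lt _ (by omega)]; simp
      · rw [show n + 1 = m + 1 + d by omega, recipQPochSub_add, inv_qPoch_self_succ hQ d]; ring
    have r4 : (qPoch (q ^ 2) (q ^ 2) (n + m + 1))⁻¹ = (1 - (q ^ n) ^ 2 * (q ^ m) ^ 2 * q ^ 4) *
        (qPoch (q ^ 2) (q ^ 2) (n + m + 2))⁻¹ := by
      rw [inv_qPoch_self_succ hQ (n + m + 1)]; ring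
    have hy : q ^ n = q ^ m * q ^ d / q := by
      rw [eq_div_iff h0, ← pow_succ, hd, pow_add]
    have key := certPoly_identity h0 (pow_ne_zero m h0) hy
    simp only [hG]
    rw [hw', r1, r2, r3, show n + (m + 1) + 1 = n + m + 2 by ring,
      show n + 1 + m + 1 = n + m + 2 by ring, r4, seedAlpha, pow_succ q m]
    simp only [hw]
    linear_combination (((-1) ^ m * q ^ m.choose 2 * (q ^ m)⁻¹) *
      ((qPoch (q ^ 2) (q ^ 2) d)⁻¹ * (qPoch (q ^ 2) (q ^ 2) (n + m + 2))⁻¹)) * key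
  rw [baileyBeta_eq_sum_of_le (q ^ 2) _ (Nat.le_succ n), baileyBeta, mul_sum, mul_sum,
    ← sum_add_distrib, sum_congr rfl hterm, sum_range_sub]
  simp only [hG]
  rw [recipQPochSub_of_lt _ (Nat.lt_succ_self _)]
  simp [certPoly]

theorem baileyBeta_seedAlpha {q : ℂ} (hq : ‖q‖ < 1) (h0 : q ≠ 0) (n : ℕ) :
    baileyBeta (q ^ 2) (seedAlpha q) n = (-1) ^ n * q ^ n ^ 2 * (q ^ (2 * n))⁻¹ *
      qPoch q (q ^ 2) n * (qPoch (q ^ 2) (q ^ 2) (2 * n))⁻¹ := by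
  have hQ := norm_sq_lt_one hq
  induction n with
  | zero =>
    have h : 1 - q ^ 2 ≠ 0 := by simpa using sub_ne_zero.2 (pow_succ_ne_one hq 1).symm
    simp [baileyBeta, seedAlpha, recipQPochSub, qPoch, h]
  | succ n ih =>
    have h1 : 1 + q ^ (2 * n + 1) ≠ 0 := by
      intro h
      apply pow_succ_ne_one hq (4 * n + 1)
      have : q ^ (2 * n + 1) = -1 := by linear_combination h
      rw [show 4 * n + 1 + 1 = (2 * n + 1) * 2 by ring, pow_mul, this]; norm_num
    have h2 : 1 - q ^ (4 * n + 4) ≠ 0 := sub_ne_zero.2 (pow_succ_ne_one hq (4 * n + 3)).symm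
    have h3 : 1 - q ^ (4 * n + 2) ≠ 0 := sub_ne_zero.2 (pow_succ_ne_one hq (4 * n + 1)).symm
    have h4 := qPoch_self_ne_zero hQ (2 * n)
    have hrec := seedBeta_recurrence hq h0 n
    rw [ih] at hrec
    apply mul_left_cancel₀ (mul_ne_zero h1 h2)
    rw [eq_neg_of_add_eq_zero_left hrec, show 2 * (n + 1) = 2 * n + 1 + 1 by ring, qPoch_succ,
      qPoch_succ, qPoch_succ, show q ^ 2 * (q ^ 2) ^ (2 * n) = q ^ (4 * n + 2) by ring,
      show q ^ 2 * (q ^ 2) ^ (2 * n + 1) = q ^ (4 * n + 4) by ring,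
      show q * (q ^ 2) ^ n = q ^ (2 * n + 1) by ring]
    have h5 : q ^ (4 * n + 2) = (q ^ (2 * n + 1)) ^ 2 := by ring
    have h6 : (1 : ℂ) - q ^ (2 * n + 1) ≠ 0 := sub_ne_zero.2 (pow_succ_ne_one hq (2 * n)).symm
    rw [h5, show 1 - (q ^ (2 * n + 1)) ^ 2 = (1 - q ^ (2 * n + 1)) * (1 + q ^ (2 * n + 1)) by ring]
    field_simp
    ring

/-- The sequence `(-1)^m q^{m(5m+1)/2 + 2K(m²+m)} (1 - q^{4m+2})`. -/
noncomputable def chainAlpha (q : ℂ) (K m : ℕ) : ℂ :=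
  (1 - q ^ (4 * m + 2)) * ((-1) ^ m * q ^ (5 * m.choose 2 + 3 * m + 2 * K * (m ^ 2 + m)))

theorem baileyBeta_chainAlpha_zero {q : ℂ} (hq : ‖q‖ < 1) (n : ℕ) :
    baileyBeta (q ^ 2) (chainAlpha q 0) n = ∑ r ∈ range (n + 1), (-1) ^ r * q ^ (3 * r ^ 2) *
      qPoch q (q ^ 2) r * recipQPochSub (q ^ 2) n r / qPoch (q ^ 2) (q ^ 2) (2 * r) := by
  rcases eq_or_ne q 0 with rfl | h0
  · rw [baileyBeta, sum_eq_single 0, sum_eq_single 0]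
    · simp [chainAlpha, qPoch]
    · intro r _ hr
      simp [hr]
    · simp
    · intro m _ hm
      simp [chainAlpha, hm]
    · simp
  · have hQ := norm_sq_lt_one hq
    have e : chainAlpha q 0 = fun m => (q ^ 2) ^ (m ^ 2 + m) * seedAlpha q m := by
      funext m
      have h1 := choose_two_add_choose_two_succ m
      rw [choose_two_succ] at h1
      rw [chainAlpha, seedAlpha, ← h1]
      field_simp
      ring
    rw [e, ← bailey_lemma hQ]
    refine sum_congr rfl fun r _ => ?_
    rw [baileyBeta_seedAlpha hq h0]
    field_simp
    ring

theorem baileyBeta_chainAlpha_succ {q : ℂ} (hq : ‖q‖ < 1) (K n : ℕ) :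
    baileyBeta (q ^ 2) (chainAlpha q (K + 1)) n = ∑ r ∈ range (n + 1),
      (q ^ 2) ^ (r ^ 2 + r) * recipQPochSub (q ^ 2) n r *
        baileyBeta (q ^ 2) (chainAlpha q K) r := by
  rw [bailey_lemma (norm_sq_lt_one hq)]
  congr 1
  funext m
  simp only [chainAlpha]
  ring

/-! ### The inner multiple sum -/

@[to_additive]
theorem prod_Icc_shift {M : Type*} [CommMonoid M] (f : ℕ → M) (n : ℕ) :
    ∏ i ∈ Icc 1 (n + 1), f i = f 1 * ∏ i ∈ Icc 1 n, f (i + 1) := by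
  rw [← Ico_add_one_right_eq_Icc, ← Ico_add_one_right_eq_Icc, prod_eq_prod_Ico_succ_bot (by omega),
    prod_Ico_add' f 1 (n + 1) 1]

theorem le_tailSum_one {k : ℕ} (ν : Fin (k - 1) → ℕ) (i : Fin (k - 1)) : ν i ≤ tailSum ν 1 := by
  have h := i.2
  have e : entry ν (i + 1) = ν i := by
    rw [entry, dif_pos (by omega)]
    rfl
  rw [← e]
  exact single_le_sum (f := entry ν) (fun _ _ => Nat.zero_le _) (mem_Icc.2 (by omega))

section Cons

variable {K : ℕ} (a : ℕ) (ν : Fin (K + 1) → ℕ)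

theorem entry_cons_one : entry (k := K + 3) (Fin.cons a ν : Fin (K + 2) → ℕ) 1 = a := by
  rw [entry, dif_pos (by omega)]
  rfl

theorem entry_cons_succ {j : ℕ} (hj : 1 ≤ j) :
    entry (k := K + 3) (Fin.cons a ν : Fin (K + 2) → ℕ) (j + 1) = entry (k := K + 2) ν j := by
  obtain ⟨i, rfl⟩ := Nat.exists_eq_add_of_le' hj
  by_cases h : i ≤ K
  · rw [entry, entry, dif_pos (by omega), dif_pos (by omega)]
    rfl
  · rw [entry, entry, dif_neg (by omega), dif_neg (by omega)]

theorem tailSum_cons_succ {j : ℕ} (hj : 1 ≤ j) :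
    tailSum (k := K + 3) (Fin.cons a ν : Fin (K + 2) → ℕ) (j + 1) = tailSum (k := K + 2) ν j := by
  rw [tailSum, tailSum, ← Ico_add_one_right_eq_Icc, ← Ico_add_one_right_eq_Icc,
    show K + 3 - 1 + 1 = (K + 2 - 1 + 1) + 1 by omega, ← sum_Ico_add' _ j _ 1]
  exact sum_congr rfl fun i hi => entry_cons_succ a ν (hj.trans (mem_Ico.1 hi).1)

theorem tailSum_cons_one :
    tailSum (k := K + 3) (Fin.cons a ν : Fin (K + 2) → ℕ) 1 = a + tailSum (k := K + 2) ν 1 := by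
  rw [tailSum, show K + 3 - 1 = (K + 1) + 1 by omega, sum_Icc_shift, entry_cons_one, tailSum]
  congr 1
  exact sum_congr rfl fun i hi => entry_cons_succ a ν (mem_Icc.1 hi).1

theorem innerTerm_cons (q : ℂ) (n : ℕ) :
    innerTerm (K + 3) q n (Fin.cons a ν : Fin (K + 2) → ℕ)
      = (q ^ 2) ^ ((a + tailSum (k := K + 2) ν 1) ^ 2 + (a + tailSum (k := K + 2) ν 1)) *
        recipQPochSub (q ^ 2) n (a + tailSum (k := K + 2) ν 1) *
        innerTerm (K + 2) q (a + tailSum (k := K + 2) ν 1) ν := by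
  have e1 : ∑ j ∈ Icc 1 K, 2 * tailSum (k := K + 3) (Fin.cons a ν : Fin (K + 2) → ℕ) (j + 1) ^ 2
      = ∑ j ∈ Icc 1 K, 2 * tailSum (k := K + 2) ν j ^ 2 :=
    sum_congr rfl fun j hj => by rw [tailSum_cons_succ a ν (mem_Icc.1 hj).1]
  have e2 : ∑ j ∈ Icc 1 K, 2 * tailSum (k := K + 3) (Fin.cons a ν : Fin (K + 2) → ℕ) (j + 1)
      = ∑ j ∈ Icc 1 K, 2 * tailSum (k := K + 2) ν j :=
    sum_congr rfl fun j hj => by rw [tailSum_cons_succ a ν (mem_Icc.1 hj).1]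
  have e3 : ∏ j ∈ Icc 1 K, qPoch (q ^ 2) (q ^ 2)
        (entry (k := K + 3) (Fin.cons a ν : Fin (K + 2) → ℕ) (j + 1))
      = ∏ j ∈ Icc 1 K, qPoch (q ^ 2) (q ^ 2) (entry (k := K + 2) ν j) :=
    prod_congr rfl fun j hj => by rw [entry_cons_succ a ν (mem_Icc.1 hj).1]
  have e4 : recipQPochSub (q ^ 2) (a + tailSum (k := K + 2) ν 1) (tailSum (k := K + 2) ν 1)
      = (qPoch (q ^ 2) (q ^ 2) a)⁻¹ := by
    rw [add_comm, recipQPochSub_add]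
  rw [innerTerm, innerTerm, e4, show K + 3 - 2 = K + 1 by omega, show K + 3 - 1 = K + 1 + 1 by omega,
    show K + 2 - 2 = K by omega, show K + 2 - 1 = K + 1 by omega, sum_Icc_shift,
    sum_Icc_shift, prod_Icc_shift, e1, e2, e3, entry_cons_one, tailSum_cons_one,
    entry_cons_succ a ν (by omega), tailSum_cons_succ a ν (by omega)]
  field_simp
  ring

end Cons

theorem innerTerm_eq_zero_of_lt {k : ℕ} {q : ℂ} {n : ℕ} {ν : Fin (k - 1) → ℕ}
    (h : n < tailSum ν 1) : innerTerm k q n ν = 0 := by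
  rw [innerTerm, recipQPochSub_of_lt _ h]
  simp

theorem innerTerm_two (q : ℂ) (n : ℕ) (ν : Fin 1 → ℕ) :
    innerTerm 2 q n ν = (-1) ^ ν 0 * q ^ (3 * ν 0 ^ 2) * qPoch q (q ^ 2) (ν 0) *
      recipQPochSub (q ^ 2) n (ν 0) / qPoch (q ^ 2) (q ^ 2) (2 * ν 0) := by
  have h1 : entry (k := 2) ν 1 = ν 0 := by
    rw [entry, dif_pos (by omega)]
    rfl
  have h2 : tailSum (k := 2) ν 1 = ν 0 := by
    rw [tailSum, show 2 - 1 = 1 from rfl, Icc_self, sum_singleton, h1]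
  rw [innerTerm, show 2 - 1 = 1 from rfl, show 2 - 2 = 0 from rfl, h1, h2]
  simp

/-- The inner multiple sum is the `β` of a Bailey pair with explicit `α`. -/
theorem hasSum_innerTerm {q : ℂ} (hq : ‖q‖ < 1) (K n : ℕ) :
    HasSum (innerTerm (K + 2) q n) (baileyBeta (q ^ 2) (chainAlpha q K) n) := by
  induction K generalizing n with
  | zero =>
    rw [baileyBeta_chainAlpha_zero hq]
    have h := hasSum_sum_of_ne_finset_zero (L := .unconditional ℕ) (s := range (n + 1)) (f := fun r : ℕ =>
      (-1) ^ r * q ^ (3 * r ^ 2) * qPoch q (q ^ 2) r * recipQPochSub (q ^ 2) n r /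
        qPoch (q ^ 2) (q ^ 2) (2 * r)) fun r hr => by
          rw [recipQPochSub_of_lt _ (by simpa using hr)]; simp
    rw [← (Equiv.funUnique (Fin 1) ℕ).hasSum_iff] at h
    exact hasSum_of_eq h (fun ν => innerTerm_two q n ν) rfl
  | succ K ih =>
    set h : ℕ × (Fin (K + 1) → ℕ) → ℂ := fun p =>
      (q ^ 2) ^ (p.1 ^ 2 + p.1) * recipQPochSub (q ^ 2) n p.1 * innerTerm (K + 2) q p.1 p.2 with hh
    have hfs : (Function.support h).Finite := by
      refine (Set.Finite.subset
        ((Set.finite_Iic n).prod (Set.finite_Iic fun _ : Fin (K + 1) => n)) fun p hp => ?_)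
      have h1 : p.1 ≤ n := by
        by_contra hc
        exact hp (by simp [hh, recipQPochSub_of_lt _ (not_le.1 hc)])
      have h2 : tailSum (k := K + 2) p.2 1 ≤ p.1 := by
        by_contra hc
        exact hp (by simp [hh, innerTerm_eq_zero_of_lt (k := K + 2) (not_le.1 hc)])
      exact ⟨h1, fun i => ((le_tailSum_one (k := K + 2) p.2 i).trans h2).trans h1⟩
    have hsupp : Summable h := summable_of_hasFiniteSupport hfs
    have hfib := hsupp.hasSum.prod_fiberwise fun r =>
      (ih r).mul_left ((q ^ 2) ^ (r ^ 2 + r) * recipQPochSub (q ^ 2) n r)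
    have hfin := hasSum_sum_of_ne_finset_zero (L := .unconditional ℕ) (s := range (n + 1)) (f := fun r : ℕ =>
      (q ^ 2) ^ (r ^ 2 + r) * recipQPochSub (q ^ 2) n r * baileyBeta (q ^ 2) (chainAlpha q K) r)
        fun r hr => by rw [recipQPochSub_of_lt _ (by simpa using hr)]; simp
    have htot : HasSum h (baileyBeta (q ^ 2) (chainAlpha q (K + 1)) n) := by
      rw [baileyBeta_chainAlpha_succ hq, ← hfib.unique hfin]
      exact hsupp.hasSum
    set ι : ℕ × (Fin (K + 1) → ℕ) → ℕ × (Fin (K + 1) → ℕ) :=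
      fun p => (p.1 + tailSum (k := K + 2) p.2 1, p.2) with hι
    have hinj : Function.Injective ι := by
      rintro ⟨a, ν⟩ ⟨b, μ⟩ hab
      simp only [hι, Prod.mk.injEq] at hab
      obtain ⟨h1, rfl⟩ := hab
      simpa using h1
    rw [← hinj.hasSum_iff] at htot
    · change HasSum (α := ℂ) (β := Fin (K + 2) → ℕ) (innerTerm (K + 3) q n) _
      rw [← (Fin.consEquiv fun _ : Fin (K + 2) => ℕ).hasSum_iff]
      exact hasSum_of_eq htot (fun p => innerTerm_cons p.1 p.2 q n) rfl
    · rintro ⟨r, ν⟩ hr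
      have : r < tailSum (k := K + 2) ν 1 := by
        by_contra hc
        exact hr ⟨(r - tailSum (k := K + 2) ν 1, ν), by
          simp only [hι, Prod.mk.injEq, and_true]; omega⟩
      simp [hh, innerTerm_eq_zero_of_lt (k := K + 2) this]

/-! ### The right-hand side as an indefinite theta series -/

theorem hasSum_natAbs_fibers {f : ℕ × ℤ → ℂ} (h : Summable f) :
    HasSum (fun n => ∑ m ∈ range (n + 1), f (m, -((n - m : ℕ) : ℤ)) +
      ∑ m ∈ range n, f (m, ((n - 1 - m : ℕ) : ℤ) + 1)) (∑' p, f p) := by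
  have h1 : Summable fun p : ℕ × ℕ => f (p.1, -(p.2 : ℤ)) :=
    h.comp_injective (i := fun p : ℕ × ℕ => (p.1, -(p.2 : ℤ))) fun a b hab => by
      simp only [Prod.mk.injEq, neg_inj, Nat.cast_inj] at hab
      exact Prod.ext hab.1 hab.2
  have h2 : Summable fun p : ℕ × ℕ => f (p.1, (p.2 : ℤ) + 1) :=
    h.comp_injective (i := fun p : ℕ × ℕ => (p.1, (p.2 : ℤ) + 1)) fun a b hab => by
      simp only [Prod.mk.injEq, add_left_inj, Nat.cast_inj] at hab
      exact Prod.ext hab.1 hab.2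
  have htot : ∑' p, f p = ∑' p : ℕ × ℕ, f (p.1, -(p.2 : ℤ))
      + ∑' p : ℕ × ℕ, f (p.1, (p.2 : ℤ) + 1) := by
    refine (h.hasSum.prod_fiberwise fun m => ?_).unique
      ((h1.hasSum.prod_fiberwise fun m => (h1.prod_factor m).hasSum).add
        (h2.hasSum.prod_fiberwise fun m => (h2.prod_factor m).hasSum))
    rw [← (Equiv.neg ℤ).hasSum_iff]
    refine HasSum.of_nat_of_neg_add_one (h1.prod_factor m).hasSum ?_
    simpa [Function.comp, neg_neg] using (h2.prod_factor m).hasSum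
  rw [htot]
  refine HasSum.add ?_ ?_
  · refine hasSum_of_eq (hasSum_antidiagonal h1.hasSum) (fun n => ?_) rfl
    rw [Nat.sum_antidiagonal_eq_sum_range_succ_mk]
  · rw [← hasSum_nat_add_iff' 1]
    refine hasSum_of_eq (hasSum_antidiagonal h2.hasSum) (fun n => ?_) (by simp)
    rw [Nat.sum_antidiagonal_eq_sum_range_succ_mk]
    rfl

/-- The general term of the indefinite theta series, indexed by `m` and `j = ±(n - m)`. -/
noncomputable def heckeTerm (z q : ℂ) (K : ℕ) (p : ℕ × ℤ) : ℂ :=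
  (-1) ^ (p.1 + p.2.natAbs) * z ^ p.2 * q ^ (5 * p.1.choose 2 + 3 * p.1 +
    2 * K * (p.1 ^ 2 + p.1) + 2 * ((p.2.natAbs + 1).choose 2 + p.1 * (p.2.natAbs + 1)))

theorem summable_heckeTerm {z q : ℂ} (hq : ‖q‖ < 1) (hz : z ≠ 0) (K : ℕ) :
    Summable (heckeTerm z q K) := by
  refine Summable.of_norm_bounded
    ((summable_geometric_of_lt_one (norm_nonneg q) hq).mul_of_nonneg
      (summable_zpow_mul_pow_choose_two (norm_nonneg q) hq (norm_pos_iff.2 hz))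
      (fun _ => by positivity) fun _ => by positivity) fun p => ?_
  simp only [heckeTerm, norm_mul, norm_zpow, norm_pow, norm_neg, norm_one, one_pow, one_mul]
  calc _ ≤ ‖z‖ ^ p.2 * ‖q‖ ^ (p.1 + (p.2.natAbs + 1).choose 2) := by
        refine mul_le_mul_of_nonneg_left (pow_le_pow_of_le_one (norm_nonneg q) hq.le ?_)
          (by positivity)
        have : 0 ≤ 2 * K * (p.1 ^ 2 + p.1) := Nat.zero_le _
        have : 0 ≤ p.1 * (p.2.natAbs + 1) := Nat.zero_le _
        omega
    _ = _ := by rw [pow_add]; ring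

theorem hecke_exponent (K m i : ℕ) :
    (2 * ((m + i : ℕ) : ℤ) ^ 2 - (m : ℤ) ^ 2 + (2 * ((m + i : ℕ) : ℤ) - m)) / 2
        + 2 * (((K + 2 : ℕ) : ℤ) - 1) * ((m : ℤ) ^ 2 + m)
      = ((5 * m.choose 2 + 3 * m + 2 * K * (m ^ 2 + m) +
          2 * ((i + 1).choose 2 + m * (i + 1)) : ℕ) : ℤ) := by
  have h1 : 2 * (m.choose 2 : ℤ) + m = (m : ℤ) ^ 2 := by
    have := choose_two_add_choose_two_succ m
    rw [choose_two_succ] at this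
    zify at this
    linarith
  have h2 : 2 * ((i + 1).choose 2 : ℤ) = (i : ℤ) ^ 2 + i := by
    have := choose_two_add_choose_two_succ i
    have h3 := choose_two_succ i
    zify at this h3
    linarith
  have h3 : 2 * ((m + i : ℕ) : ℤ) ^ 2 - (m : ℤ) ^ 2 + (2 * ((m + i : ℕ) : ℤ) - m)
      = (m + m.choose 2 + 2 * m * i + 2 * (i + 1).choose 2) * 2 := by
    push_cast
    linear_combination -h1 - 2 * h2
  rw [h3, Int.mul_ediv_cancel _ two_ne_zero]
  push_cast
  linear_combination -2 * h1

theorem rightTerm_eq_sum_heckeTerm (K : ℕ) (z q : ℂ) (n : ℕ) :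
    rightTerm (K + 2) z q n = ∑ m ∈ range (n + 1), heckeTerm z q K (m, -((n - m : ℕ) : ℤ)) +
      ∑ m ∈ range n, heckeTerm z q K (m, ((n - 1 - m : ℕ) : ℤ) + 1) := by
  rw [rightTerm]
  congr 1
  · rw [Nat.range_succ_eq_Icc_zero]
    refine sum_congr rfl fun m hm => ?_
    obtain ⟨i, rfl⟩ := Nat.exists_eq_add_of_le (mem_Icc.1 hm).2
    rw [hecke_exponent, zpow_natCast]
    simp only [heckeTerm, Nat.add_sub_cancel_left, Int.natAbs_neg, Int.natAbs_natCast]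
    rw [show (m : ℤ) - ((m + i : ℕ) : ℤ) = -(i : ℤ) by push_cast; ring]
  · rw [← Ico_add_one_right_eq_Icc, ← sum_Ico_add' _ 0 n 1, ← range_eq_Ico]
    refine sum_congr rfl fun m hm => ?_
    obtain ⟨i, rfl⟩ := Nat.exists_eq_add_of_lt (mem_range.1 hm)
    have e := hecke_exponent K m (i + 1)
    rw [show m + i + 1 - 1 - m = i by omega, show m + i + 1 = m + (i + 1) by ring]
    have e1 : 2 * ((m + (i + 1) : ℕ) : ℤ) ^ 2 - ((m + 1 : ℕ) : ℤ) ^ 2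
        + (2 * ((m + (i + 1) : ℕ) : ℤ) + ((m + 1 : ℕ) : ℤ))
        = 2 * ((m + (i + 1) : ℕ) : ℤ) ^ 2 - (m : ℤ) ^ 2 + (2 * ((m + (i + 1) : ℕ) : ℤ) - m) := by
      push_cast; ring
    have e2 : ((m + 1 : ℕ) : ℤ) ^ 2 - ((m + 1 : ℕ) : ℤ) = (m : ℤ) ^ 2 + m := by push_cast; ring
    have e3 : ((m + (i + 1) : ℕ) : ℤ) - ((m + 1 : ℕ) : ℤ) + 1 = (i : ℤ) + 1 := by push_cast; ring
    have e4 : ((i : ℤ) + 1).natAbs = i + 1 := by omega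
    rw [e1, e2, e3, e, zpow_natCast]
    simp only [heckeTerm, e4]

theorem hasSum_rightTerm {z q : ℂ} (hq : ‖q‖ < 1) (hz : z ≠ 0) (K : ℕ) :
    HasSum (rightTerm (K + 2) z q) (∑' p, heckeTerm z q K p) :=
  hasSum_of_eq (hasSum_natAbs_fibers (summable_heckeTerm hq hz K))
    (rightTerm_eq_sum_heckeTerm K z q) rfl

/-! ### The left-hand side -/

theorem norm_chainAlpha_le {q : ℂ} (hq : ‖q‖ < 1) (K m : ℕ) : ‖chainAlpha q K m‖ ≤ 2 := by
  have h : ∀ e : ℕ, ‖q ^ e‖ ≤ 1 := fun e => by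
    rw [norm_pow]; exact pow_le_one₀ (norm_nonneg q) hq.le
  rw [chainAlpha, norm_mul, norm_mul, norm_pow (-1 : ℂ), norm_neg, norm_one, one_pow, one_mul]
  have h1 : ‖1 - q ^ (4 * m + 2)‖ ≤ 1 + 1 :=
    (norm_sub_le _ _).trans (by rw [norm_one]; gcongr; exact h _)
  calc _ ≤ (1 + 1 : ℝ) * 1 := by gcongr; exact h _
    _ = 2 := by norm_num

/-- The general term of the left-hand side, indexed by `m` and `n - m`, after the inner sum has
been replaced by its Bailey pair expression. -/
noncomputable def baileyTerm (z q : ℂ) (K : ℕ) (p : ℕ × ℕ) : ℂ :=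
  chainAlpha q K p.1 * (qPoch (q ^ 2) (q ^ 2) (2 * (p.1 + p.2)) * (q ^ 2) ^ (p.1 + p.2) /
    (qPoch (z * q ^ 2) (q ^ 2) (p.1 + p.2) * qPoch (z⁻¹ * q ^ 2) (q ^ 2) (p.1 + p.2)) *
    ((qPoch (q ^ 2) (q ^ 2) p.2)⁻¹ * (qPoch (q ^ 2) (q ^ 2) (2 * p.1 + p.2 + 1))⁻¹))

theorem summable_baileyTerm {z q : ℂ} (hq : ‖q‖ < 1) (hz₁ : ∀ i : ℕ, z * q ^ 2 * (q ^ 2) ^ i ≠ 1)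
    (hz₂ : ∀ i : ℕ, z⁻¹ * q ^ 2 * (q ^ 2) ^ i ≠ 1) (K : ℕ) : Summable (baileyTerm z q K) := by
  have hQ := norm_sq_lt_one hq
  obtain ⟨A, hA, hA'⟩ := exists_norm_qPoch_le hQ (q ^ 2)
  obtain ⟨B, hB, hB'⟩ := exists_norm_inv_qPoch_le hQ (self_mul_pow_ne_one hQ)
  obtain ⟨C, hC, hC'⟩ := exists_norm_inv_qPoch_le hQ hz₁
  obtain ⟨D, hD, hD'⟩ := exists_norm_inv_qPoch_le hQ hz₂
  have hgeo := summable_geometric_of_lt_one (norm_nonneg (q ^ 2)) hQ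
  refine Summable.of_norm_bounded
    ((hgeo.mul_of_nonneg hgeo (fun _ => by positivity) fun _ => by positivity).mul_left
      (2 * (A * (C * D) * (B * B)))) fun p => ?_
  rw [baileyTerm, div_eq_mul_inv, mul_inv, norm_mul, norm_mul, norm_mul, norm_mul, norm_mul,
    norm_mul, norm_pow (q ^ 2)]
  calc _ ≤ 2 * (A * ‖q ^ 2‖ ^ (p.1 + p.2) * (C * D) * (B * B)) := by
        gcongr
        · exact norm_chainAlpha_le hq K _
        · exact hA' _
        · exact hC' _
        · exact hD' _
        · exact hB' _
        · exact hB' _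
    _ = _ := by rw [pow_add]; ring

theorem leftTerm_eq_sum_baileyTerm {q : ℂ} (hq : ‖q‖ < 1) (z : ℂ) (K n : ℕ) :
    leftTerm (K + 2) z q n = ∑ p ∈ antidiagonal n, baileyTerm z q K p := by
  rw [leftTerm, (hasSum_innerTerm hq K n).tsum_eq, baileyBeta,
    Nat.sum_antidiagonal_eq_sum_range_succ_mk, mul_sum]
  refine sum_congr rfl fun m hm => ?_
  obtain ⟨d, rfl⟩ := Nat.exists_eq_add_of_le (Nat.lt_succ_iff.1 (mem_range.1 hm))
  rw [baileyTerm, Nat.add_sub_cancel_left, recipQPochSub_add,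
    show m + d + m + 1 = 2 * m + d + 1 by ring, pow_mul]
  ring

theorem hasSum_leftTerm {z q : ℂ} (hq : ‖q‖ < 1) (hz₁ : ∀ i : ℕ, z * q ^ 2 * (q ^ 2) ^ i ≠ 1)
    (hz₂ : ∀ i : ℕ, z⁻¹ * q ^ 2 * (q ^ 2) ^ i ≠ 1) (K : ℕ) :
    HasSum (leftTerm (K + 2) z q) (∑' p, baileyTerm z q K p) :=
  hasSum_of_eq (hasSum_antidiagonal (summable_baileyTerm hq hz₁ hz₂ K).hasSum)
    (leftTerm_eq_sum_baileyTerm hq z K) rfl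

theorem mul_tsum_baileyTerm {z q : ℂ} (hq : ‖q‖ < 1) (hz : z ≠ 0)
    (hz₁ : ∀ i : ℕ, z * q ^ 2 * (q ^ 2) ^ i ≠ 1)
    (hz₂ : ∀ i : ℕ, z⁻¹ * q ^ 2 * (q ^ 2) ^ i ≠ 1) (K : ℕ) :
    qPochInf (z * q ^ 2) (q ^ 2) * qPochInf (z⁻¹ * q ^ 2) (q ^ 2) * qPochInf (q ^ 2) (q ^ 2)
      * ∑' p, baileyTerm z q K p = ∑' p, heckeTerm z q K p := by
  have hQ := norm_sq_lt_one hq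
  set P := qPochInf (z * q ^ 2) (q ^ 2) * qPochInf (z⁻¹ * q ^ 2) (q ^ 2) *
    qPochInf (q ^ 2) (q ^ 2) with hP
  have hs := (summable_baileyTerm hq hz₁ hz₂ K).mul_left P
  have hH := summable_heckeTerm hq hz K
  rw [← tsum_mul_left, hs.tsum_prod, hH.tsum_prod]
  refine tsum_congr fun m => ?_
  have hconj := (hasSum_conjugate_bailey hQ hz hz₁ hz₂ m).mul_left (chainAlpha q K m)
  have h2 : 1 - q ^ (4 * m + 2) ≠ 0 := sub_ne_zero.2 (pow_succ_ne_one hq (4 * m + 1)).symm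
  have hrow := hasSum_of_eq (g := fun j : ℤ => heckeTerm z q K (m, j)) hconj (fun j => by
    rw [heckeTerm, chainAlpha, show (q ^ 2) ^ (2 * m + 1) = q ^ (4 * m + 2) by ring]
    field_simp
    ring) rfl
  rw [hrow.tsum_eq, ← tsum_mul_left]
  refine tsum_congr fun s => ?_
  rw [baileyTerm, hP]
  ring

end HeckeRogers

theorem theorem1p5 (k : ℕ) (hk : 2 ≤ k) (z q : ℂ) (hq : ‖q‖ < 1) (hz : z ≠ 0)
    (hz₁ : ∀ i : ℕ, z * q ^ 2 * (q ^ 2) ^ i ≠ 1)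
    (hz₂ : ∀ i : ℕ, z⁻¹ * q ^ 2 * (q ^ 2) ^ i ≠ 1) :
    (∀ n : ℕ, Summable (HeckeRogers.innerTerm k q n)) ∧
    Summable (HeckeRogers.leftTerm k z q) ∧
    Summable (HeckeRogers.rightTerm k z q) ∧
    HeckeRogers.qPochInf (z * q ^ 2) (q ^ 2) * HeckeRogers.qPochInf (z⁻¹ * q ^ 2) (q ^ 2)
        * HeckeRogers.qPochInf (q ^ 2) (q ^ 2) * ∑' n : ℕ, HeckeRogers.leftTerm k z q n
      = ∑' n : ℕ, HeckeRogers.rightTerm k z q n := by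
  obtain ⟨K, rfl⟩ := Nat.exists_eq_add_of_le' hk
  have hL := HeckeRogers.hasSum_leftTerm hq hz₁ hz₂ K
  have hR := HeckeRogers.hasSum_rightTerm hq hz K
  refine ⟨fun n => (HeckeRogers.hasSum_innerTerm hq K n).summable, hL.summable, hR.summable, ?_⟩
  rw [hL.tsum_eq, hR.tsum_eq, HeckeRogers.mul_tsum_baileyTerm hq hz hz₁ hz₂ K]
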